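/- Let $(\mathbb X,\|\cdot\|)$ be a quasi-Banach space over $\mathbb F=\mathbb R$ or $\mathbb C$. Let $\mathcal B=(e_n)_{n\ge1}$ be a semi-normalized Markushevich basis of $\mathbb X$: there are continuous linear functionals $e_n^*$ on $\mathbb X$ with $e_i^*(e_j)=\delta_{i,j}$, there are $0<c_1\le c_2<\infty$ with $c_1\le\|e_n\|,\|e_n^*\|_*\le c_2$ for all $n$, the linear span of $(e_n)$ is dense in $\mathbb X$, and $x=0$ whenever $e_n^*(x)=0$ for all $n$. Assume that $\mathcal B$ is unconditional, that is, the projections $P_A(x)=\sum_{n\in A}e_n^*(x)e_n$ satisfy $\sup_{|A|<\infty}\|P_A\|<\infty$. For $m\ge1$ and $x\in\mathbb X$ let $$\sigma_m(x)=\inf\Big\{\Big\|x-\sum_{n\in A}b_ne_n\Big\|: |A|=m,\ b_n\in\mathbb F\Big\},\qquad \gamma_m(x)=\sup_\pi\Big\|x-\sum_{n=1}^m e^*_{\pi(n)}(x)e_{\pi(n)}\Big\|,$$ where $\pi$ runs over the greedy orderings of $x$, i.e. the one-to-one maps $\pi:\mathbb N\to\mathbb N$ with $\{n:e_n^*(x)\ne0\}\subset\pi(\mathbb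 N)$ and $|e^*_{\pi(i)}(x)|\ge|e^*_{\pi(j)}(x)|$ whenever $i\le j$. The basis is greedy if $\gamma_m(x)\asymp\sigma_m(x)$ with constants independent of $x$ and $m$. Let $\omega=(\omega(n))_{n\ge1}$ be a doubling weight, i.e. $0<\omega(1)\le\omega(2)\le\cdots$, $\lim_n\omega(n)=\infty$, and there is $\theta\ge 1$ with $\omega(2n)\le\theta\,\omega(n)$ for all $n\ge1$. Assume that its lower dilation index is positive: $$i_\omega=\sup_{M>1}\frac{\ln\varphi_\omega(M)}{\ln M}>0,\qquad \varphi_\omega(M)=\inf_{k\ge1}\frac{\omega(Mk)}{\omega(k)}.$$ For $q\in(0,\infty)$ let $\mathcal A_q^\omega$ be the set of those $x\in\mathbb X$ for which $$\|x\|_{\mathcal A_q^\omega}=\|x\|+\Big[\sum_{n=1}^\infty(\omega(n)\sigma_n(x))^q\frac1n\Big]^{1/q}<\infty,$$ with the usual modification $\|x\|_{\mathcal A_\infty^\omega}=\|x\|+\sup_{n\ge1}\omega(n)\sigma_n(x)$ for $q=\infty$, and define $\mathcal G_q^\omega$ and $\|\cdot\|_{\mathcal G_q^\omega}$ in the same way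 with $\gamma_n$ in place of $\sigma_n$. Write $\mathcal A_q^\omega\approx\mathcal G_q^\omega$ if $\mathcal A_q^\omega=\mathcal G_q^\omega$ as sets and there is $C>0$ with $C^{-1}\|x\|_{\mathcal A_q^\omega}\le\|x\|_{\mathcal G_q^\omega}\le C\|x\|_{\mathcal A_q^\omega}$ for all $x$ in this set. Then: 1. If $\mathcal B$ is greedy, then $\mathcal A_q^\omega\approx\mathcal G_q^\omega$ for all $q\in(0,\infty]$. 2. If $\mathcal A_q^\omega\approx\mathcal G_q^\omega$ for some $q\in(0,\infty]$, then $\mathcal B$ is greedy. -/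

import Mathlib

open scoped ENNReal Topology

namespace GreedyApprox

/-- `X` with the function `‖·‖` is a quasi-Banach space over `𝕜` (`ℝ` or `ℂ`): `‖·‖` is a
quasi-norm, and `X` is complete for it. The quasi-norm is not assumed to be continuous. -/
class IsQuasiBanach (𝕜 X : Type*) [RCLike 𝕜] [AddCommGroup X] [Module 𝕜 X] [Norm X] : Prop where
  norm_nonneg : ∀ x : X, 0 ≤ ‖x‖
  norm_eq_zero : ∀ x : X, ‖x‖ = 0 ↔ x = 0
  norm_smul : ∀ (t : 𝕜) (x : X), ‖t • x‖ = ‖t‖ * ‖x‖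
  norm_add_le : ∃ κ : ℝ, 1 ≤ κ ∧ ∀ x y : X, ‖x + y‖ ≤ κ * (‖x‖ + ‖y‖)
  complete : ∀ u : ℕ → X,
    (∀ ε : ℝ, 0 < ε → ∃ N : ℕ, ∀ m n : ℕ, N ≤ m → N ≤ n → ‖u m - u n‖ < ε) →
      ∃ x : X, Filter.Tendsto (fun n => ‖u n - x‖) Filter.atTop (𝓝 0)

section Basis

variable {𝕜 X : Type*} [RCLike 𝕜] [AddCommGroup X] [Module 𝕜 X] [Norm X]

/-- The dual norm `‖f‖_* = sup {|f x| : ‖x‖ ≤ 1}` of a linear functional, with values in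
`[0, ∞]`; it is finite exactly when `f` is continuous. -/
noncomputable def dualNorm (f : X →ₗ[𝕜] 𝕜) : ℝ≥0∞ :=
  ⨆ (x : X) (_ : ‖x‖ ≤ 1), ENNReal.ofReal ‖f x‖

variable (𝕜 X) in
/-- A semi-normalized Markushevich basis: the vectors `e n` with their biorthogonal functionals
`coord n` (which `e` determines, by continuity and density of the span). -/
structure MBasis where
  /-- the basis vectors -/
  e : ℕ → X
  /-- the biorthogonal functionals `e_n^*` -/
  coord : ℕ → (X →ₗ[𝕜] 𝕜)
  biorthogonal : ∀ i j : ℕ, coord i (e j) = if i = j then 1 else 0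
  semi_normalized : ∃ c₁ c₂ : ℝ, 0 < c₁ ∧ ∀ n : ℕ,
    (c₁ ≤ ‖e n‖ ∧ ‖e n‖ ≤ c₂) ∧
    (ENNReal.ofReal c₁ ≤ dualNorm (coord n) ∧ dualNorm (coord n) ≤ ENNReal.ofReal c₂)
  dense_span : ∀ x : X, ∀ ε : ℝ, 0 < ε →
    ∃ y ∈ Submodule.span 𝕜 (Set.range e), ‖x - y‖ < ε
  total : ∀ x : X, (∀ n : ℕ, coord n x = 0) → x = 0

/-- The coordinate projection `P_A x = ∑_{n ∈ A} e_n^*(x) e_n`. -/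
noncomputable def MBasis.proj (B : MBasis 𝕜 X) (A : Finset ℕ) (x : X) : X :=
  ∑ n ∈ A, B.coord n x • B.e n

/-- The basis is unconditional: `sup_A ‖P_A‖ < ∞` over the finite sets `A`. -/
def MBasis.IsUnconditional (B : MBasis 𝕜 X) : Prop :=
  ∃ K : ℝ, ∀ (A : Finset ℕ) (x : X), ‖B.proj A x‖ ≤ K * ‖x‖

/-- The `m`-term error `σ_m(x) = inf {‖x - ∑_{n ∈ A} b_n e_n‖ : |A| = m, b_n ∈ 𝕜}`. -/
noncomputable def MBasis.sigma (B : MBasis 𝕜 X) (m : ℕ) (x : X) : ℝ≥0∞ :=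
  ⨅ (A : Finset ℕ) (_ : A.card = m) (b : ℕ → 𝕜),
    ENNReal.ofReal ‖x - ∑ n ∈ A, b n • B.e n‖

/-- `π` is a greedy ordering of `x`: it is one-to-one, its range contains the support of `x`, and
it lists the coefficients of `x` in nonincreasing order of modulus. (`π` is not required to be
onto: no bijection lists the coefficients in nonincreasing order if infinitely many of them are
nonzero and some of them vanish.) -/
structure MBasis.IsGreedyOrdering (B : MBasis 𝕜 X) (x : X) (π : ℕ → ℕ) : Prop where
  injective : Function.Injective π
  support_subset : ∀ n : ℕ, B.coord n x ≠ 0 → n ∈ Set.range π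
  antitone : ∀ i j : ℕ, i ≤ j → ‖B.coord (π j) x‖ ≤ ‖B.coord (π i) x‖

/-- The greedy sum of order `m`, i.e. the sum of the first `m` terms of `x` along `π`. -/
noncomputable def MBasis.greedySum (B : MBasis 𝕜 X) (π : ℕ → ℕ) (m : ℕ) (x : X) : X :=
  ∑ i ∈ Finset.range m, B.coord (π i) x • B.e (π i)

/-- The `m`-th greedy error `γ_m(x) = sup_π ‖x - G_m^π(x)‖` over the greedy orderings of `x`. -/
noncomputable def MBasis.gamma (B : MBasis 𝕜 X) (m : ℕ) (x : X) : ℝ≥0∞ :=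
  ⨆ (π : ℕ → ℕ) (_ : B.IsGreedyOrdering x π), ENNReal.ofReal ‖x - B.greedySum π m x‖

/-- The basis is greedy: `γ_m(x) ≍ σ_m(x)`, with constants independent of `x` and `m`. -/
def MBasis.IsGreedy (B : MBasis 𝕜 X) : Prop :=
  ∃ C : ℝ, 0 < C ∧ ∀ (x : X) (m : ℕ), 1 ≤ m →
    B.gamma m x ≤ ENNReal.ofReal C * B.sigma m x ∧
    B.sigma m x ≤ ENNReal.ofReal C * B.gamma m x

/-- For errors `err m x` and a weight `ω`, the quantity
`‖x‖ + (∑_{n ≥ 1} (ω(n) err_n(x))^q / n)^{1/q}`, or `‖x‖ + sup_{n ≥ 1} ω(n) err_n(x)` if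
`q = ∞`, in `[0, ∞]`. Only the values `ω n` with `n ≥ 1` are used. -/
noncomputable def classNorm (ω : ℕ → ℝ) (q : ℝ≥0∞) (err : ℕ → X → ℝ≥0∞) (x : X) : ℝ≥0∞ :=
  ENNReal.ofReal ‖x‖ +
    if q = ∞ then ⨆ n : ℕ, ENNReal.ofReal (ω (n + 1)) * err (n + 1) x
    else (∑' n : ℕ, (ENNReal.ofReal (ω (n + 1)) * err (n + 1) x) ^ q.toReal /
      ((n + 1 : ℕ) : ℝ≥0∞)) ^ (1 / q.toReal)

/-- `‖x‖` in the approximation space `𝒜_q^ω`, which consists of the `x` where it is finite. -/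
noncomputable def MBasis.approxNorm (B : MBasis 𝕜 X) (ω : ℕ → ℝ) (q : ℝ≥0∞) : X → ℝ≥0∞ :=
  classNorm ω q B.sigma

/-- `‖x‖` in the greedy class `𝒢_q^ω`, which consists of the `x` where it is finite. -/
noncomputable def MBasis.greedyNorm (B : MBasis 𝕜 X) (ω : ℕ → ℝ) (q : ℝ≥0∞) : X → ℝ≥0∞ :=
  classNorm ω q B.gamma

end Basis

section Embedding

variable {X : Type*}

/-- `Y ↪ Z` for `Y = {x : Φ x < ∞}` and `Z = {x : Ψ x < ∞}`: `Y ⊆ Z`, and there is `C > 0` with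
`Ψ x ≤ C Φ x` for all `x ∈ Y`. -/
def Embeds (Φ Ψ : X → ℝ≥0∞) : Prop :=
  {x | Φ x < ∞} ⊆ {x | Ψ x < ∞} ∧
    ∃ C : ℝ, 0 < C ∧ ∀ x : X, Φ x < ∞ → Ψ x ≤ ENNReal.ofReal C * Φ x

/-- `Y ≈ Z`: each of the two spaces embeds in the other one. -/
def EquivalentSpaces (Φ Ψ : X → ℝ≥0∞) : Prop :=
  Embeds Φ Ψ ∧ Embeds Ψ Φ

end Embedding

/-- Doubling weights `ω = (ω(n))_{n ≥ 1}`; the value `ω 0` is irrelevant. -/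
structure IsDoublingWeight (ω : ℕ → ℝ) : Prop where
  pos : ∀ n : ℕ, 1 ≤ n → 0 < ω n
  mono : ∀ m n : ℕ, 1 ≤ m → m ≤ n → ω m ≤ ω n
  tendsto : Filter.Tendsto ω Filter.atTop Filter.atTop
  doubling : ∃ θ : ℝ, 1 ≤ θ ∧ ∀ n : ℕ, 1 ≤ n → ω (2 * n) ≤ θ * ω n

/-- The lower dilation sequence `φ_ω(M) = inf_{k ≥ 1} ω(M k) / ω(k)`. -/
noncomputable def lowerDilation (ω : ℕ → ℝ) (M : ℕ) : ℝ :=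
  ⨅ k : ℕ, ω (M * (k + 1)) / ω (k + 1)

/-- The lower dilation index `i_ω = sup_{M > 1} ln φ_ω(M) / ln M`. -/
noncomputable def lowerDilationIndex (ω : ℕ → ℝ) : EReal :=
  ⨆ (M : ℕ) (_ : 1 < M), ((Real.log (lowerDilation ω M) / Real.log M : ℝ) : EReal)

end GreedyApprox

namespace GreedyApprox

/-! ### Finite sums in a quasi-normed space. -/

section QuasiNorm

variable {X : Type*} [AddCommGroup X] [Norm X]

/-! Since `σ_m ≤ γ_m` for every such basis, the equivalence of the two spaces is about embedding
`𝒜_q^ω` into `𝒢_q^ω`. If the basis is greedy, the errors are comparable term by term, and the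
sequence norms are monotone and homogeneous.

For the converse, write `1_A` for the sum of `e n` over `A` and test the embedding on `x = 1_A + 2 ·
1_D` with `A`, `D` disjoint and `|A| ≤ |D|`. The greedy algorithm uses up `D` first, so by
unconditionality `γ_m(x)` is at least a multiple of `‖1_A‖` for `m ≤ |D|`, and the greedy norm is at
least of order `ω(|D|) ‖1_A‖`. On the other side, `σ_m(x) ≤ ‖x‖` for all `m`, `σ_m(x) ≤ 2‖1_D‖` once
`m ≥ |A|`, and `σ_m(x) = 0` once `m ≥ |A| + |D|`. Hence the approximation norm is at most of order
`ω(|A|)(‖1_A‖ + ‖1_D‖) + ω(|D|) ‖1_D‖`. The positive index makes `ω(|D|)` much larger than `ω(|A|)`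
when `|D| ≥ L|A|`; the term with `‖1_A‖` is then absorbed, leaving `‖1_A‖ ≲ ‖1_D‖`
(`exists_norm_sum_le_of_embeds`). Cutting `A` into boundedly many pieces removes the factor `L`, so
the basis is democratic (`isDemocratic_of_embeds`).

Democracy and unconditionality give greediness by the Konyagin–Temlyakov argument
(`IsDemocratic.isGreedy`). It needs `‖∑ u_n e_n‖ ≲ ‖∑ v_n e_n‖ ` for `|u_n| ≤ |v_n|`, which without
local convexity is proved by a digit expansion (`norm_sum_smul_le_of_mem_Icc`). -/

theorem norm_sum_le_of_forall_le {ι : Type*} {κ M : ℝ} (hκ : 1 ≤ κ)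
    (hadd : ∀ x y : X, ‖x + y‖ ≤ κ * (‖x‖ + ‖y‖)) (h0 : ‖(0 : X)‖ = 0) (hM : 0 ≤ M)
    (s : Finset ι) (v : ι → X) (hv : ∀ i ∈ s, ‖v i‖ ≤ M) :
    ‖∑ i ∈ s, v i‖ ≤ (2 * κ) ^ s.card * M := by
  classical
  induction s using Finset.induction_on with
  | empty => simpa [h0] using hM
  | insert i s hi ih =>
    rw [Finset.sum_insert hi, Finset.card_insert_of_notMem hi, pow_succ]
    have h1 := hv i (Finset.mem_insert_self i s)
    have h2 := ih fun j hj => hv j (Finset.mem_insert_of_mem hj)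
    have h3 : M ≤ (2 * κ) ^ s.card * M :=
      le_mul_of_one_le_left hM (one_le_pow₀ (by linarith))
    calc ‖v i + ∑ j ∈ s, v j‖ ≤ κ * (‖v i‖ + ‖∑ j ∈ s, v j‖) := hadd _ _
      _ ≤ κ * ((2 * κ) ^ s.card * M + (2 * κ) ^ s.card * M) := by gcongr; linarith
      _ = (2 * κ) ^ s.card * (2 * κ) * M := by ring

/-- Splitting a finite set into at most `k` pieces of at most `d` elements. -/
theorem norm_sum_le_of_card_le_mul {ι : Type*} {κ M : ℝ} (hκ : 1 ≤ κ)
    (hadd : ∀ x y : X, ‖x + y‖ ≤ κ * (‖x‖ + ‖y‖)) (hM : 0 ≤ M)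
    (v : ι → X) (d k : ℕ) (s : Finset ι) (hs : s.card ≤ k * d)
    (hv : ∀ t ⊆ s, t.card ≤ d → ‖∑ i ∈ t, v i‖ ≤ M) :
    ‖∑ i ∈ s, v i‖ ≤ (2 * κ) ^ k * M := by
  classical
  induction k generalizing s with
  | zero =>
    simpa using hv s subset_rfl (by lia)
  | succ k ih =>
    have hone : M ≤ (2 * κ) ^ k * M := le_mul_of_one_le_left hM (one_le_pow₀ (by linarith))
    by_cases hd : s.card ≤ d
    · exact (hv s subset_rfl hd).trans
        (le_mul_of_one_le_left hM (one_le_pow₀ (by linarith)))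
    · obtain ⟨t, hts, htd⟩ := Finset.exists_subset_card_eq (le_of_not_ge hd)
      have hcard : (s \ t).card ≤ k * d := by
        rw [Finset.card_sdiff_of_subset hts, htd]
        rw [Nat.succ_mul] at hs
        lia
      have h1 := ih (s \ t) hcard fun u hu => hv u (hu.trans Finset.sdiff_subset)
      have h2 := hv t hts htd.le
      rw [← Finset.sum_sdiff hts, pow_succ]
      calc _ ≤ κ * (‖∑ i ∈ s \ t, v i‖ + ‖∑ i ∈ t, v i‖) := hadd _ _
        _ ≤ κ * ((2 * κ) ^ k * M + (2 * κ) ^ k * M) := by gcongr; linarith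
        _ = (2 * κ) ^ k * (2 * κ) * M := by ring

end QuasiNorm

/-! ### Bounded multipliers without convexity. -/

section Multipliers

variable {𝕜 X : Type*} [RCLike 𝕜] [AddCommGroup X] [Module 𝕜 X] [Norm X]

/-- Layer-cake decomposition: an integer combination with coefficients at most `b` is a sum of `b`
partial sums, over the sets where `d` exceeds `0, ..., b - 1`. -/
theorem norm_sum_natCast_smul_le {ι : Type*} {κ M : ℝ} (hκ : 1 ≤ κ)
    (hadd : ∀ x y : X, ‖x + y‖ ≤ κ * (‖x‖ + ‖y‖)) (h0 : ‖(0 : X)‖ = 0) (hM : 0 ≤ M)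
    (F : Finset ι) (y : ι → X) (hF : ∀ G ⊆ F, ‖∑ n ∈ G, y n‖ ≤ M) (b : ℕ) (d : ι → ℕ)
    (hd : ∀ n ∈ F, d n ≤ b) :
    ‖∑ n ∈ F, ((d n : ℝ) : 𝕜) • y n‖ ≤ (2 * κ) ^ b * M := by
  classical
  have hsum : ∑ n ∈ F, ((d n : ℝ) : 𝕜) • y n =
      ∑ j ∈ Finset.range b, ∑ n ∈ F with j < d n, y n := by
    simp_rw [Finset.sum_filter]
    rw [Finset.sum_comm]
    refine Finset.sum_congr rfl fun n hn => ?_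
    rw [← Finset.sum_filter, Finset.sum_const]
    have : (Finset.range b).filter (fun j => j < d n) = Finset.range (d n) := by
      ext j
      have := hd n hn
      simp only [Finset.mem_filter, Finset.mem_range]
      lia
    rw [this, Finset.card_range]
    simp [Nat.cast_smul_eq_nsmul]
  rw [hsum]
  simpa using norm_sum_le_of_forall_le hκ hadd h0 hM (Finset.range b) _
    fun j _ => hF _ (Finset.filter_subset _ _)

variable [IsQuasiBanach 𝕜 X]

/-- A bound for the partial sums of a finite family bounds its multiples by coefficients in
`[0, 1]`. The supremum `S` of these multiples satisfies `S ≤ (C + S) / 2`, by splitting off the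
first digit of the coefficients in base `b`. -/
theorem norm_sum_smul_le_of_mem_Icc {ι : Type*} {κ M : ℝ} (hκ : 1 ≤ κ)
    (hadd : ∀ x y : X, ‖x + y‖ ≤ κ * (‖x‖ + ‖y‖)) (hM : 0 ≤ M)
    (F : Finset ι) (y : ι → X) (hF : ∀ G ⊆ F, ‖∑ n ∈ G, y n‖ ≤ M) (b : ℕ) (hb : 2 * κ ≤ b)
    (a : ι → ℝ) (ha : ∀ n ∈ F, a n ∈ Set.Icc (0 : ℝ) 1) :
    ‖∑ n ∈ F, (a n : 𝕜) • y n‖ ≤ (2 * κ) ^ b * M := by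
  classical
  have h0 : ‖(0 : X)‖ = 0 := (IsQuasiBanach.norm_eq_zero 𝕜 0).2 rfl
  set T : Set ℝ := {r | ∃ a : ι → ℝ, (∀ n ∈ F, a n ∈ Set.Icc (0 : ℝ) 1) ∧
    r = ‖∑ n ∈ F, (a n : 𝕜) • y n‖} with hT
  -- This bound depends on `F`; it serves only to make the supremum finite, so that it can be
  -- absorbed.
  have hbdd : BddAbove T := by
    refine ⟨(2 * κ) ^ F.card * M, ?_⟩
    rintro r ⟨a, ha, rfl⟩
    refine norm_sum_le_of_forall_le hκ hadd h0 hM F _ fun n hn => ?_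
    rw [IsQuasiBanach.norm_smul, RCLike.norm_ofReal, abs_of_nonneg (ha n hn).1]
    have h1 : ‖y n‖ ≤ M := by simpa using hF {n} (by simpa using hn)
    calc a n * ‖y n‖ ≤ 1 * M := mul_le_mul (ha n hn).2 h1
          (IsQuasiBanach.norm_nonneg 𝕜 _) zero_le_one
      _ = M := one_mul M
  have hbpos : (0 : ℝ) < b := by linarith
  have hstep : ∀ r ∈ T, r ≤ ((2 * κ) ^ b * M + sSup T) / 2 := by
    rintro r ⟨a, ha, rfl⟩
    have hab : ∀ n ∈ F, 0 ≤ a n * b := fun n hn => mul_nonneg (ha n hn).1 hbpos.le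
    have hdig : ‖∑ n ∈ F, (((⌊a n * b⌋₊ : ℕ) : ℝ) : 𝕜) • y n‖ ≤ (2 * κ) ^ b * M := by
      refine norm_sum_natCast_smul_le hκ hadd h0 hM F y hF b _ fun n hn => ?_
      refine Nat.floor_le_of_le ?_
      nlinarith [(ha n hn).2]
    have hrem : ‖∑ n ∈ F, ((a n * b - (⌊a n * b⌋₊ : ℕ) : ℝ) : 𝕜) • y n‖ ≤ sSup T := by
      refine le_csSup hbdd ⟨fun n => a n * b - (⌊a n * b⌋₊ : ℕ), fun n hn => ?_, rfl⟩
      have h1 := Nat.floor_le (hab n hn)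
      have h2 := Nat.lt_floor_add_one (a n * b)
      exact ⟨by linarith, by linarith⟩
    have hsplit : ∑ n ∈ F, (a n : 𝕜) • y n = ((b : ℝ) : 𝕜)⁻¹ •
        (∑ n ∈ F, (((⌊a n * b⌋₊ : ℕ) : ℝ) : 𝕜) • y n +
          ∑ n ∈ F, ((a n * b - (⌊a n * b⌋₊ : ℕ) : ℝ) : 𝕜) • y n) := by
      rw [← Finset.sum_add_distrib, Finset.smul_sum]
      refine Finset.sum_congr rfl fun n _ => ?_
      rw [← add_smul, smul_smul]
      congr 1
      have : ((b : ℝ) : 𝕜) ≠ 0 := by exact_mod_cast hbpos.ne'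
      rw [← RCLike.ofReal_add]
      field_simp
      push_cast
      ring
    rw [hsplit, IsQuasiBanach.norm_smul, norm_inv, RCLike.norm_ofReal, abs_of_pos hbpos]
    have h3 := hadd (∑ n ∈ F, (((⌊a n * b⌋₊ : ℕ) : ℝ) : 𝕜) • y n)
      (∑ n ∈ F, ((a n * b - (⌊a n * b⌋₊ : ℕ) : ℝ) : 𝕜) • y n)
    rw [inv_mul_le_iff₀ hbpos]
    have h4 : 0 ≤ (2 * κ) ^ b * M + sSup T :=
      (add_nonneg (IsQuasiBanach.norm_nonneg 𝕜 _) (IsQuasiBanach.norm_nonneg 𝕜 _)).trans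
        (add_le_add hdig hrem)
    nlinarith
  have hne : T.Nonempty := ⟨_, a, ha, rfl⟩
  have h5 := csSup_le hne hstep
  have h6 := le_csSup hbdd (⟨a, ha, rfl⟩ : ‖∑ n ∈ F, (a n : 𝕜) • y n‖ ∈ T)
  linarith

variable (𝕜 X) in
theorem exists_norm_sum_smul_le : ∃ C : ℝ, 0 < C ∧ ∀ {ι : Type} (M : ℝ) (F : Finset ι)
    (y : ι → X), (∀ G ⊆ F, ‖∑ n ∈ G, y n‖ ≤ M) → ∀ a : ι → 𝕜, (∀ n ∈ F, ‖a n‖ ≤ 1) →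
      ‖∑ n ∈ F, a n • y n‖ ≤ C * M := by
  obtain ⟨κ, hκ, hadd⟩ := IsQuasiBanach.norm_add_le 𝕜 (X := X)
  obtain ⟨b, hb⟩ := exists_nat_ge (2 * κ)
  have h0 : ‖(0 : X)‖ = 0 := (IsQuasiBanach.norm_eq_zero 𝕜 0).2 rfl
  refine ⟨(2 * κ) ^ 4 * (2 * κ) ^ b, by positivity, fun {ι} M F y hF a ha => ?_⟩
  have hM : 0 ≤ M := h0.symm.le.trans (by simpa using hF ∅ (Finset.empty_subset _))
  -- Positive and negative parts of the real and imaginary parts; for real scalars `RCLike.I = 0`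
  -- and the last two terms vanish.
  let u : Fin 4 → ι → ℝ := ![fun n => max (RCLike.re (a n)) 0, fun n => max (-RCLike.re (a n)) 0,
    fun n => max (RCLike.im (a n)) 0, fun n => max (-RCLike.im (a n)) 0]
  let s : Fin 4 → 𝕜 := ![1, -1, RCLike.I, -RCLike.I]
  have hsplit : ∑ n ∈ F, a n • y n = ∑ i : Fin 4, s i • ∑ n ∈ F, (u i n : 𝕜) • y n := by
    simp_rw [Finset.smul_sum]
    rw [Finset.sum_comm]
    refine Finset.sum_congr rfl fun n _ => ?_
    simp_rw [smul_smul]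
    rw [← Finset.sum_smul]
    congr 1
    have key : ∀ t : ℝ, ((max t 0 : ℝ) : 𝕜) - ((max (-t) 0 : ℝ) : 𝕜) = (t : 𝕜) := fun t => by
      rw [← RCLike.ofReal_sub, max_zero_sub_max_neg_zero_eq_self]
    simp only [Fin.sum_univ_four, s, u, Matrix.cons_val]
    linear_combination (-1 : 𝕜) * RCLike.re_add_im (a n) - key (RCLike.re (a n))
      - RCLike.I * key (RCLike.im (a n))
  have hs : ∀ i, ‖s i‖ ≤ 1 := by
    have hI : ‖(RCLike.I : 𝕜)‖ ≤ 1 := by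
      rcases eq_or_ne (RCLike.I : 𝕜) 0 with h | h
      · simp [h]
      · exact (RCLike.norm_I_of_ne_zero h).le
    intro i
    fin_cases i <;> simp [s, hI]
  have hu : ∀ i, ∀ n ∈ F, u i n ∈ Set.Icc (0 : ℝ) 1 := by
    intro i n hn
    have h1 := abs_le.1 ((RCLike.abs_re_le_norm (a n)).trans (ha n hn))
    have h2 := abs_le.1 ((RCLike.abs_im_le_norm (a n)).trans (ha n hn))
    fin_cases i <;> simp [u] <;> linarith
  rw [hsplit]
  have := norm_sum_le_of_forall_le (M := (2 * κ) ^ b * M) hκ hadd h0 (by positivity)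
    (Finset.univ : Finset (Fin 4)) (fun i => s i • ∑ n ∈ F, (u i n : 𝕜) • y n) fun i _ => by
      rw [IsQuasiBanach.norm_smul]
      exact (mul_le_of_le_one_left (IsQuasiBanach.norm_nonneg 𝕜 _) (hs i)).trans
        (norm_sum_smul_le_of_mem_Icc hκ hadd hM F y hF b hb (u i) (hu i))
  simpa [mul_assoc] using this

end Multipliers

/-- A real sequence with finitely many terms above each positive level can be listed in
nonincreasing order, up to vanishing terms. -/
theorem exists_antitone_injective (c : ℕ → ℝ) (hc : ∀ n, 0 ≤ c n)
    (hfin : ∀ ε : ℝ, 0 < ε → {n | ε ≤ c n}.Finite) :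
    ∃ π : ℕ → ℕ, Function.Injective π ∧ (∀ n, c n ≠ 0 → n ∈ Set.range π) ∧
      ∀ i j, i ≤ j → c (π j) ≤ c (π i) := by
  classical
  -- Off any finite set the maximum is attained; choosing a maximizer repeatedly gives the listing.
  have hmax : ∀ s : Finset ℕ, ∃ n, n ∉ s ∧ ∀ k, k ∉ s → c k ≤ c n := by
    intro s
    by_cases h : ∃ n, n ∉ s ∧ 0 < c n
    · obtain ⟨n, hn, hpos⟩ := h
      obtain ⟨k, hk, hkmax⟩ := Set.exists_max_image {k | c n ≤ c k ∧ k ∉ s} c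
        ((hfin (c n) hpos).subset fun k hk => hk.1) ⟨n, le_rfl, hn⟩
      refine ⟨k, hk.2, fun i hi => ?_⟩
      rcases le_total (c n) (c i) with h1 | h1
      · exact hkmax i ⟨h1, hi⟩
      · exact h1.trans hk.1
    · push Not at h
      obtain ⟨n, hn⟩ := Infinite.exists_notMem_finset s
      exact ⟨n, hn, fun k hk => (h k hk).trans (hc n)⟩
  choose g hg hgmax using hmax
  let S : ℕ → Finset ℕ := fun k => Nat.rec ∅ (fun _ s => insert (g s) s) k
  have hS : ∀ k, S (k + 1) = insert (g (S k)) (S k) := fun k => rfl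
  have hmono : Monotone S := monotone_nat_of_le_succ fun k => by
    rw [hS]; exact Finset.subset_insert _ _
  have hmem : ∀ i j, i < j → g (S i) ∈ S j := fun i j hij =>
    hmono (Nat.succ_le_of_lt hij) (by rw [Nat.succ_eq_add_one, hS]; exact Finset.mem_insert_self _ _)
  have hinj : Function.Injective fun k => g (S k) := by
    refine Function.Injective.of_lt_imp_ne fun i j hij h => ?_
    have h1 := hmem i j hij
    rw [h] at h1
    exact hg _ h1
  have hSmem : ∀ k n, n ∈ S k → n ∈ Set.range fun k => g (S k) := by
    intro k n
    induction k with
    | zero => intro h; exact absurd h (Finset.notMem_empty n)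
    | succ k ih =>
      rw [hS, Finset.mem_insert]
      rintro (rfl | h)
      · exact ⟨k, rfl⟩
      · exact ih h
  refine ⟨fun k => g (S k), hinj, fun n hn => ?_, fun i j hij => ?_⟩
  -- An index never listed would stay below every chosen term, so infinitely many terms would be at
  -- least `c n > 0`.
  · by_contra hrange
    have hpos : 0 < c n := lt_of_le_of_ne (hc n) hn.symm
    refine Set.infinite_range_of_injective hinj ((hfin (c n) hpos).subset ?_)
    rintro _ ⟨k, rfl⟩
    exact hgmax (S k) n fun h => hrange (hSmem k n h)
  · exact hgmax (S i) _ fun h => hg (S j) (hmono hij h)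

/-! ### Greedy orderings and the Konyagin–Temlyakov criterion. -/

section Basis

variable {𝕜 X : Type*} [RCLike 𝕜] [AddCommGroup X] [Module 𝕜 X] [Norm X]

theorem norm_le_mul_of_dualNorm_le [IsQuasiBanach 𝕜 X] {f : X →ₗ[𝕜] 𝕜} {c : ℝ} (hc : 0 ≤ c)
    (hf : dualNorm f ≤ ENNReal.ofReal c) (x : X) : ‖f x‖ ≤ c * ‖x‖ := by
  rcases (IsQuasiBanach.norm_nonneg 𝕜 x).eq_or_lt with h | h
  · rw [(IsQuasiBanach.norm_eq_zero 𝕜 x).1 h.symm, map_zero, norm_zero]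
    exact mul_nonneg hc (IsQuasiBanach.norm_nonneg 𝕜 _)
  · have hn : ‖((‖x‖ : ℝ) : 𝕜)⁻¹‖ = ‖x‖⁻¹ := by
      rw [norm_inv, RCLike.norm_ofReal, abs_of_pos h]
    have h1 : ‖((‖x‖ : ℝ) : 𝕜)⁻¹ • x‖ ≤ 1 := by
      rw [IsQuasiBanach.norm_smul, hn, inv_mul_cancel₀ h.ne']
    have h2 := (le_iSup₂ (f := fun (x : X) (_ : ‖x‖ ≤ 1) => ENNReal.ofReal ‖f x‖) _ h1).trans hf
    rw [ENNReal.ofReal_le_ofReal_iff hc, map_smul, smul_eq_mul, norm_mul, hn,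
      inv_mul_le_iff₀ h] at h2
    linarith

namespace MBasis

variable (B : MBasis 𝕜 X)

theorem coord_sum_smul (n : ℕ) (A : Finset ℕ) (b : ℕ → 𝕜) :
    B.coord n (∑ i ∈ A, b i • B.e i) = if n ∈ A then b n else 0 := by
  simp [map_sum, B.biorthogonal]

theorem coord_sum (n : ℕ) (A : Finset ℕ) :
    B.coord n (∑ i ∈ A, B.e i) = if n ∈ A then 1 else 0 := by
  simp [map_sum, B.biorthogonal]

theorem coord_proj (n : ℕ) (A : Finset ℕ) (x : X) :
    B.coord n (B.proj A x) = if n ∈ A then B.coord n x else 0 :=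
  B.coord_sum_smul n A fun n => B.coord n x

theorem proj_congr {A : Finset ℕ} {x y : X} (h : ∀ n ∈ A, B.coord n x = B.coord n y) :
    B.proj A x = B.proj A y :=
  Finset.sum_congr rfl fun n hn => by rw [h n hn]

theorem proj_eq_sum {A : Finset ℕ} {x : X} (h : ∀ n ∈ A, B.coord n x = 1) :
    B.proj A x = ∑ n ∈ A, B.e n :=
  Finset.sum_congr rfl fun n hn => by rw [h n hn, one_smul]

theorem greedySum_eq_proj {π : ℕ → ℕ} (hπ : Function.Injective π) (m : ℕ) (x : X) :
    B.greedySum π m x = B.proj ((Finset.range m).image π) x := by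
  rw [greedySum, proj, Finset.sum_image fun i _ j _ h => hπ h]

theorem finite_coord_ne_zero {y : X} (hy : y ∈ Submodule.span 𝕜 (Set.range B.e)) :
    {n | B.coord n y ≠ 0}.Finite := by
  induction hy using Submodule.span_induction with
  | mem x hx =>
    obtain ⟨i, rfl⟩ := hx
    refine (Set.finite_singleton i).subset fun n hn => ?_
    by_contra h
    exact hn (by rw [B.biorthogonal, if_neg (show ¬n = i from h)])
  | zero => simp
  | add x y _ _ hx hy =>
    refine (hx.union hy).subset fun n hn => ?_
    by_contra h
    simp only [Set.mem_union, Set.mem_ofPred_eq, not_or, not_not] at h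
    exact hn (by rw [map_add, h.1, h.2, add_zero])
  | smul a x _ hx =>
    refine hx.subset fun n hn h => hn ?_
    rw [map_smul, h, smul_zero]

theorem sigma_le {m : ℕ} {A : Finset ℕ} (hA : A.card ≤ m) (b : ℕ → 𝕜) (x : X) :
    B.sigma m x ≤ ENNReal.ofReal ‖x - ∑ n ∈ A, b n • B.e n‖ := by
  classical
  obtain ⟨A', hAA', hA'⟩ := Infinite.exists_superset_card_eq A m hA
  refine iInf_le_of_le A' (iInf_le_of_le hA' (iInf_le_of_le (fun n => if n ∈ A then b n else 0) ?_))
  refine le_of_eq ?_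
  congr 3
  simp only [ite_smul, zero_smul]
  rw [← Finset.sum_filter, Finset.filter_mem_eq_inter, Finset.inter_eq_right.2 hAA']

variable [IsQuasiBanach 𝕜 X]

/-- The coefficients of `x` tend to zero: `x` is close to a finitely supported vector and the
functionals are uniformly bounded. Without an ordering the supremum defining `γ_m` would be empty,
hence `0`. -/
theorem exists_isGreedyOrdering (x : X) : ∃ π, B.IsGreedyOrdering x π := by
  obtain ⟨c₁, c₂, hc₁, hc⟩ := B.semi_normalized
  have hc₂ : 0 < c₂ := hc₁.trans_le ((hc 0).1.1.trans (hc 0).1.2)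
  obtain ⟨π, h1, h2, h3⟩ := exists_antitone_injective (fun n => ‖B.coord n x‖)
    (fun n => norm_nonneg _) fun ε hε => by
      obtain ⟨y, hy, hxy⟩ := B.dense_span x (ε / c₂) (by positivity)
      refine (B.finite_coord_ne_zero hy).subset fun n hn h => ?_
      have h1 := norm_le_mul_of_dualNorm_le hc₂.le (hc n).2.2 (x - y)
      rw [map_sub, h, sub_zero] at h1
      rw [lt_div_iff₀ hc₂] at hxy
      have h2 : ε ≤ ‖B.coord n x‖ := hn
      linarith
  exact ⟨π, h1, fun n hn => h2 n (norm_ne_zero_iff.2 hn), h3⟩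

theorem sigma_le_gamma (m : ℕ) (x : X) : B.sigma m x ≤ B.gamma m x := by
  obtain ⟨π, hπ⟩ := B.exists_isGreedyOrdering x
  refine le_iSup₂_of_le π hπ ?_
  rw [B.greedySum_eq_proj hπ.injective]
  exact B.sigma_le (by simpa using Finset.card_image_le (s := Finset.range m) (f := π)) _ x

/-- The norm of a sum of basis vectors over a finite set dominates, up to a constant, that over any
disjoint set with at most as many elements. -/
def IsDemocratic (B : MBasis 𝕜 X) : Prop :=
  ∃ C : ℝ, ∀ A D : Finset ℕ, Disjoint A D → A.card ≤ D.card →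
    ‖∑ n ∈ A, B.e n‖ ≤ C * ‖∑ n ∈ D, B.e n‖

variable {B}

theorem IsUnconditional.exists_pos (hB : B.IsUnconditional) :
    ∃ K : ℝ, 0 < K ∧ ∀ (A : Finset ℕ) (x : X), ‖B.proj A x‖ ≤ K * ‖x‖ := by
  obtain ⟨K, hK⟩ := hB
  refine ⟨max K 1, by positivity, fun A x => (hK A x).trans ?_⟩
  exact mul_le_mul_of_nonneg_right (le_max_left _ _) (IsQuasiBanach.norm_nonneg 𝕜 x)

/-- The subsums of `∑ v_n e_n` are its coordinate projections, so the multiplier bound applies with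
the coefficients `u_n / v_n`. -/
theorem IsUnconditional.exists_multiplier_bound (hB : B.IsUnconditional) :
    ∃ C : ℝ, 0 < C ∧ ∀ (F : Finset ℕ) (u v : ℕ → 𝕜), (∀ n ∈ F, ‖u n‖ ≤ ‖v n‖) →
      ‖∑ n ∈ F, u n • B.e n‖ ≤ C * ‖∑ n ∈ F, v n • B.e n‖ := by
  obtain ⟨K, hK0, hK⟩ := hB.exists_pos
  obtain ⟨C, hC, h⟩ := exists_norm_sum_smul_le 𝕜 X
  refine ⟨C * K, by positivity, fun F u v huv => ?_⟩
  have h1 := h (K * ‖∑ n ∈ F, v n • B.e n‖) F (fun n => v n • B.e n) (fun G hG => by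
    have h2 := hK G (∑ n ∈ F, v n • B.e n)
    have h3 : B.proj G (∑ n ∈ F, v n • B.e n) = ∑ n ∈ G, v n • B.e n :=
      Finset.sum_congr rfl fun n hn => by rw [coord_sum_smul, if_pos (hG hn)]
    rwa [h3] at h2) (fun n => u n / v n) fun n hn => by
      rw [norm_div]
      exact div_le_one_of_le₀ (huv n hn) (norm_nonneg _)
  have h4 : ∑ n ∈ F, (u n / v n) • v n • B.e n = ∑ n ∈ F, u n • B.e n := by
    refine Finset.sum_congr rfl fun n hn => ?_
    rw [smul_smul]
    by_cases hv : v n = 0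
    · have := huv n hn
      rw [hv, norm_zero, norm_le_zero_iff] at this
      rw [this, zero_div, zero_mul]
    · rw [div_mul_cancel₀ _ hv]
  rw [h4] at h1
  rwa [mul_assoc]

/-- For a competitor `z` supported on `A` and a greedy set `G`, the remainder of `x` is `(x - z) -
P_{A ∪ G}(x - z) + P_{A \ G} x`. Democracy moves the last term from `A \ G` to `G \ A`, where the
coefficients of `x` are larger and agree with those of `x - z`. -/
theorem IsDemocratic.isGreedy (hD : B.IsDemocratic) (hB : B.IsUnconditional) : B.IsGreedy := by
  classical
  obtain ⟨κ, hκ, hadd⟩ := IsQuasiBanach.norm_add_le 𝕜 (X := X)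
  obtain ⟨K, hK0, hK⟩ := hB.exists_pos
  obtain ⟨C, hC, hmul⟩ := hB.exists_multiplier_bound
  obtain ⟨Δ₀, hΔ₀⟩ := hD
  obtain ⟨Δ, hΔ0, hΔ⟩ : ∃ Δ : ℝ, 0 < Δ ∧ ∀ A D : Finset ℕ, Disjoint A D → A.card ≤ D.card →
      ‖∑ n ∈ A, B.e n‖ ≤ Δ * ‖∑ n ∈ D, B.e n‖ :=
    ⟨max Δ₀ 1, by positivity, fun A D h h' => (hΔ₀ A D h h').trans
      (mul_le_mul_of_nonneg_right (le_max_left _ _) (IsQuasiBanach.norm_nonneg 𝕜 _))⟩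
  set E : ℝ := κ * (κ * (1 + K) + C * (Δ * (C * K))) with hE
  have hE1 : 1 ≤ E := by
    have : 0 ≤ C * (Δ * (C * K)) := by positivity
    nlinarith [mul_nonneg (by linarith : (0 : ℝ) ≤ κ) hK0.le]
  have hneg : ∀ x : X, ‖-x‖ = ‖x‖ := fun x => by
    have := IsQuasiBanach.norm_smul (-1 : 𝕜) x
    simpa using this
  refine ⟨E, by linarith, fun x m _ => ⟨?_, (B.sigma_le_gamma m x).trans
    (le_mul_of_one_le_left zero_le (by simpa using hE1))⟩⟩
  have hE0 : ENNReal.ofReal E ≠ 0 := by simpa using by linarith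
  rw [mul_comm, ← ENNReal.div_le_iff_le_mul (Or.inl hE0) (Or.inl ENNReal.ofReal_ne_top)]
  refine le_iInf₂ fun A hA => le_iInf fun b => ?_
  rw [ENNReal.div_le_iff_le_mul (Or.inl hE0) (Or.inl ENNReal.ofReal_ne_top),
    mul_comm, ← ENNReal.ofReal_mul (by linarith)]
  refine iSup₂_le fun π hπ => ENNReal.ofReal_le_ofReal ?_
  rw [B.greedySum_eq_proj hπ.injective]
  set G := (Finset.range m).image π with hG
  set z := ∑ n ∈ A, b n • B.e n with hz
  have hGcard : G.card = m := by
    rw [hG, Finset.card_image_of_injective _ hπ.injective, Finset.card_range]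
  have hcz : ∀ n, n ∉ A → B.coord n (x - z) = B.coord n x := fun n hn => by
    rw [map_sub, hz, coord_sum_smul, if_neg hn, sub_zero]
  have hsplit : x - B.proj G x =
      ((x - z) + -B.proj (A ∪ G) (x - z)) + B.proj (A \ G) x := by
    have h1 : B.proj (A ∪ G) x = B.proj (A \ G) x + B.proj G x := by
      rw [← Finset.sdiff_union_self_eq_union]
      exact Finset.sum_union Finset.sdiff_disjoint
    have h2 : B.proj (A ∪ G) (x - z) = B.proj (A ∪ G) x - z := by
      have h3 : B.proj (A ∪ G) z = z := by
        rw [proj, ← Finset.sum_subset (Finset.subset_union_left (s₁ := A) (s₂ := G))]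
        · exact Finset.sum_congr rfl fun n hn => by rw [hz, coord_sum_smul, if_pos hn]
        · intro n _ hn
          rw [hz, coord_sum_smul, if_neg hn, zero_smul]
      nth_rw 2 [← h3]
      simp [proj, map_sub, sub_smul]
    rw [h2, h1]
    abel
  have hfirst : ‖(x - z) + -B.proj (A ∪ G) (x - z)‖ ≤ κ * (1 + K) * ‖x - z‖ := by
    refine (hadd _ _).trans ?_
    rw [hneg, mul_assoc]
    gcongr
    linarith [hK (A ∪ G) (x - z)]
  have hsecond : ‖B.proj (A \ G) x‖ ≤ C * (Δ * (C * K)) * ‖x - z‖ := by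
    -- The modulus of the first coefficient left out, at `π m`, separates the coefficients in `G`
    -- from those outside.
    obtain ⟨t, ht0, htA, htG⟩ : ∃ t : ℝ, 0 ≤ t ∧ (∀ n ∈ A \ G, ‖B.coord n x‖ ≤ t) ∧
        ∀ n ∈ G \ A, t ≤ ‖B.coord n x‖ := by
      refine ⟨‖B.coord (π m) x‖, norm_nonneg _, fun n hn => ?_, fun n hn => ?_⟩
      · by_cases hn0 : B.coord n x = 0
        · rw [hn0, norm_zero]; exact norm_nonneg _
        · obtain ⟨i, rfl⟩ := hπ.support_subset n hn0
          refine hπ.antitone m i ?_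
          by_contra hi
          exact (Finset.mem_sdiff.1 hn).2
            (Finset.mem_image_of_mem π (Finset.mem_range.2 (not_le.1 hi)))
      · obtain ⟨i, hi, rfl⟩ := Finset.mem_image.1 (Finset.mem_sdiff.1 hn).1
        exact hπ.antitone i m (Finset.mem_range.1 hi).le
    have htn : ‖(t : 𝕜)‖ = t := by rw [RCLike.norm_ofReal, abs_of_nonneg ht0]
    have hcard : (A \ G).card ≤ (G \ A).card :=
      (Finset.card_sdiff_comm (hA.trans hGcard.symm)).le
    have h1 : ‖B.proj (A \ G) x‖ ≤ C * ‖∑ n ∈ A \ G, (t : 𝕜) • B.e n‖ :=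
      hmul _ _ _ fun n hn => by rw [htn]; exact htA n hn
    have h2 : ‖∑ n ∈ G \ A, (t : 𝕜) • B.e n‖ ≤ C * ‖B.proj (G \ A) x‖ :=
      hmul _ _ _ fun n hn => by rw [htn]; exact htG n hn
    have h3 : ‖B.proj (G \ A) x‖ ≤ K * ‖x - z‖ := by
      rw [← B.proj_congr fun n hn => hcz n (Finset.mem_sdiff.1 hn).2]
      exact hK _ _
    have h4 : ‖∑ n ∈ A \ G, (t : 𝕜) • B.e n‖ ≤ Δ * ‖∑ n ∈ G \ A, (t : 𝕜) • B.e n‖ := by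
      rw [← Finset.smul_sum, ← Finset.smul_sum, IsQuasiBanach.norm_smul, IsQuasiBanach.norm_smul,
        htn, mul_left_comm]
      exact mul_le_mul_of_nonneg_left (hΔ _ _ (disjoint_sdiff_sdiff) hcard) ht0
    calc ‖B.proj (A \ G) x‖ ≤ C * (Δ * (C * (K * ‖x - z‖))) := by
          refine h1.trans ?_
          gcongr
          refine h4.trans ?_
          gcongr
          refine h2.trans ?_
          gcongr
      _ = _ := by ring
  rw [hsplit]
  calc _ ≤ κ * (‖(x - z) + -B.proj (A ∪ G) (x - z)‖ + ‖B.proj (A \ G) x‖) := hadd _ _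
    _ ≤ κ * (κ * (1 + K) * ‖x - z‖ + C * (Δ * (C * K)) * ‖x - z‖) := by gcongr
    _ = E * ‖x - z‖ := by rw [hE]; ring

end MBasis

end Basis

/-! ### Weighted sequence norms. -/

section WeightedNorm

/-- The norm of a sequence in `ℓ^q` with the weights `1 / (n + 1)`. -/
noncomputable def weightedNorm (q : ℝ≥0∞) (f : ℕ → ℝ≥0∞) : ℝ≥0∞ :=
  if q = ∞ then ⨆ n, f n
  else (∑' n : ℕ, f n ^ q.toReal / ((n + 1 : ℕ) : ℝ≥0∞)) ^ (1 / q.toReal)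

theorem classNorm_eq {X : Type*} [Norm X] (ω : ℕ → ℝ) (q : ℝ≥0∞) (err : ℕ → X → ℝ≥0∞) (x : X) :
    classNorm ω q err x = ENNReal.ofReal ‖x‖ +
      weightedNorm q fun n => ENNReal.ofReal (ω (n + 1)) * err (n + 1) x := rfl

theorem weightedNorm_mono (q : ℝ≥0∞) {f g : ℕ → ℝ≥0∞} (h : ∀ n, f n ≤ g n) :
    weightedNorm q f ≤ weightedNorm q g := by
  unfold weightedNorm
  split_ifs
  · exact iSup_mono h
  · gcongr with n
    exact h n

theorem weightedNorm_const_mul {q : ℝ≥0∞} (hq : 0 < q) (c : ℝ≥0∞) (f : ℕ → ℝ≥0∞) :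
    weightedNorm q (fun n => c * f n) = c * weightedNorm q f := by
  unfold weightedNorm
  split_ifs with h
  · rw [ENNReal.mul_iSup]
  · have hq' : 0 < q.toReal := ENNReal.toReal_pos hq.ne' h
    simp_rw [ENNReal.mul_rpow_of_nonneg _ _ hq'.le, mul_div_assoc]
    rw [ENNReal.tsum_mul_left, ENNReal.mul_rpow_of_nonneg _ _ (by positivity),
      ← ENNReal.rpow_mul, mul_one_div_cancel hq'.ne', ENNReal.rpow_one]

/-- The quasi-triangle inequality, for a sequence dominated by the maximum of two others. -/
theorem exists_weightedNorm_le_add {q : ℝ≥0∞} (hq : 0 < q) :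
    ∃ C : ℝ, 0 < C ∧ ∀ f g h : ℕ → ℝ≥0∞, (∀ n, f n ≤ g n ∨ f n ≤ h n) →
      weightedNorm q f ≤ ENNReal.ofReal C * (weightedNorm q g + weightedNorm q h) := by
  by_cases hq' : q = ∞
  · refine ⟨1, one_pos, fun f g h hf => ?_⟩
    simp only [weightedNorm, hq', if_true, ENNReal.ofReal_one, one_mul]
    refine iSup_le fun n => ?_
    rcases hf n with h1 | h1
    · exact h1.trans ((le_iSup g n).trans le_self_add)
    · exact h1.trans ((le_iSup h n).trans le_add_self)
  · have hr : 0 < q.toReal := ENNReal.toReal_pos hq.ne' hq'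
    refine ⟨2 ^ (1 / q.toReal), by positivity, fun f g h hf => ?_⟩
    simp only [weightedNorm, hq', if_false]
    rw [← ENNReal.ofReal_rpow_of_pos two_pos, ENNReal.ofReal_ofNat]
    set G := ∑' n : ℕ, g n ^ q.toReal / ((n + 1 : ℕ) : ℝ≥0∞)
    set H := ∑' n : ℕ, h n ^ q.toReal / ((n + 1 : ℕ) : ℝ≥0∞)
    have h1 : ∑' n : ℕ, f n ^ q.toReal / ((n + 1 : ℕ) : ℝ≥0∞) ≤ 2 * max G H := by
      calc _ ≤ ∑' n : ℕ, (g n ^ q.toReal / ((n + 1 : ℕ) : ℝ≥0∞) +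
              h n ^ q.toReal / ((n + 1 : ℕ) : ℝ≥0∞)) := by
            refine ENNReal.tsum_le_tsum fun n => ?_
            rcases hf n with h1 | h1
            · exact le_add_right (by gcongr)
            · exact le_add_left (by gcongr)
        _ = G + H := ENNReal.tsum_add
        _ ≤ 2 * max G H := by
            rw [two_mul]
            exact add_le_add (le_max_left _ _) (le_max_right _ _)
    calc _ ≤ (2 * max G H) ^ (1 / q.toReal) := by gcongr
      _ = 2 ^ (1 / q.toReal) * (max G H) ^ (1 / q.toReal) :=
          ENNReal.mul_rpow_of_nonneg _ _ (by positivity)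
      _ ≤ _ := by
          gcongr
          rcases max_choice G H with h2 | h2 <;> rw [h2]
          · exact le_self_add
          · exact le_add_self

theorem classNorm_le_of_le {X : Type*} [Norm X] {ω : ℕ → ℝ} {q : ℝ≥0∞} (hq : 0 < q)
    {err err' : ℕ → X → ℝ≥0∞} {C : ℝ} (hC : 1 ≤ C) (x : X)
    (h : ∀ m, 1 ≤ m → err m x ≤ ENNReal.ofReal C * err' m x) :
    classNorm ω q err x ≤ ENNReal.ofReal C * classNorm ω q err' x := by
  rw [classNorm_eq, classNorm_eq, mul_add, ← weightedNorm_const_mul hq]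
  refine add_le_add (le_mul_of_one_le_left zero_le (by simpa using hC))
    (weightedNorm_mono q fun n => ?_)
  rw [mul_left_comm]
  gcongr
  exact h _ (by lia)

end WeightedNorm

/-! ### Consequences of doubling and of the positive index. -/

section Weights

variable {ω : ℕ → ℝ}

theorem IsDoublingWeight.exists_dilation (hω : IsDoublingWeight ω)
    (hi : 0 < lowerDilationIndex ω) :
    ∃ (M : ℕ) (l : ℝ), 1 < M ∧ 1 < l ∧ ∀ k, 1 ≤ k → l * ω k ≤ ω (M * k) := by
  unfold lowerDilationIndex at hi
  simp only [lt_iSup_iff] at hi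
  obtain ⟨M, hM, h⟩ := hi
  have h1 : 0 < Real.log (lowerDilation ω M) / Real.log M := by exact_mod_cast h
  have hlog : 0 < Real.log M := Real.log_pos (by exact_mod_cast hM)
  have h2 : 0 < Real.log (lowerDilation ω M) := (div_pos_iff_of_pos_right hlog).1 h1
  have hnn : ∀ k : ℕ, 0 ≤ ω (M * (k + 1)) / ω (k + 1) := fun k =>
    div_nonneg (hω.pos _ (Nat.mul_pos (by lia) k.succ_pos)).le (hω.pos _ (by lia)).le
  have h3 : 0 ≤ lowerDilation ω M := Real.iInf_nonneg hnn
  refine ⟨M, lowerDilation ω M, hM, (Real.log_pos_iff h3).1 h2, fun k hk => ?_⟩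
  obtain ⟨k, rfl⟩ : ∃ j, k = j + 1 := ⟨k - 1, by lia⟩
  rw [← le_div_iff₀ (hω.pos _ hk)]
  exact ciInf_le ⟨0, by rintro _ ⟨k, rfl⟩; exact hnn k⟩ k

theorem IsDoublingWeight.exists_mul_le (hω : IsDoublingWeight ω)
    (hi : 0 < lowerDilationIndex ω) (R : ℝ) :
    ∃ L : ℕ, 1 ≤ L ∧ ∀ k n, 1 ≤ k → L * k ≤ n → R * ω k ≤ ω n := by
  obtain ⟨M, l, hM, hl, hd⟩ := hω.exists_dilation hi
  obtain ⟨j, hj⟩ := pow_unbounded_of_one_lt R hl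
  have hpow : ∀ i k, 1 ≤ k → l ^ i * ω k ≤ ω (M ^ i * k) := by
    intro i
    induction i with
    | zero => simp
    | succ i ih =>
      intro k hk
      have h1 := hd (M ^ i * k) (Nat.mul_pos (pow_pos (by lia) i) hk)
      calc l ^ (i + 1) * ω k = l * (l ^ i * ω k) := by ring
        _ ≤ l * ω (M ^ i * k) := by gcongr; exact ih k hk
        _ ≤ _ := h1
        _ = ω (M ^ (i + 1) * k) := by rw [← mul_assoc, pow_succ']
  refine ⟨M ^ j, Nat.one_le_pow _ _ (by lia), fun k n hk hn => ?_⟩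
  calc R * ω k ≤ l ^ j * ω k := mul_le_mul_of_nonneg_right hj.le (hω.pos k hk).le
    _ ≤ ω (M ^ j * k) := hpow j k hk
    _ ≤ ω n := hω.mono _ _ (Nat.mul_pos (pow_pos (by lia) j) hk) hn

/-- Iterating a dilation that gains a factor `l > 1` gains any prescribed factor `R`. -/
theorem IsDoublingWeight.exists_sum_le (hω : IsDoublingWeight ω)
    (hi : 0 < lowerDilationIndex ω) {r : ℝ} (hr : 0 < r) :
    ∃ D : ℝ, 0 < D ∧ ∀ m, 1 ≤ m →
      ∑ n ∈ Finset.range m, ω (n + 1) ^ r / (n + 1 : ℕ) ≤ D * ω m ^ r := by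
  obtain ⟨M, l, hM, hl, hd⟩ := hω.exists_dilation hi
  have hlr : 1 < l ^ r := Real.one_lt_rpow hl hr
  have hMpos : (0 : ℝ) < M := by exact_mod_cast (by lia : 0 < M)
  refine ⟨M * l ^ r / (l ^ r - 1), div_pos (by positivity) (by linarith), fun m => ?_⟩
  -- The fixed point of `D ↦ D / l ^ r + M`: below `m / M` the induction hypothesis gains `l ^ r`,
  -- and above it there are at most `m` terms, each at most `ω m ^ r * (M / m)`.
  set D := M * l ^ r / (l ^ r - 1) with hD
  have hDpos : 0 < D := div_pos (by positivity) (by linarith)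
  have hDeq : D / l ^ r + M = D := by
    have : l ^ r - 1 ≠ 0 := by linarith
    rw [hD]
    field_simp
    ring
  induction m using Nat.strong_induction_on with
  | _ m ih =>
    intro hm
    have hωm := hω.pos m hm
    have hkm : m / M < m := Nat.div_lt_self hm hM
    have hlow : ∑ n ∈ Finset.range (m / M), ω (n + 1) ^ r / (n + 1 : ℕ) ≤
        D / l ^ r * ω m ^ r := by
      rcases Nat.eq_zero_or_pos (m / M) with h0 | h0
      · rw [h0]
        simp only [Finset.range_zero, Finset.sum_empty]
        positivity
      · refine (ih _ hkm h0).trans ?_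
        have h1 : l * ω (m / M) ≤ ω m := (hd _ h0).trans
          (hω.mono _ _ (Nat.mul_pos (by lia) h0) (Nat.mul_div_le m M))
        have h2 : l ^ r * ω (m / M) ^ r ≤ ω m ^ r := by
          rw [← Real.mul_rpow (by linarith) (hω.pos _ h0).le]
          exact Real.rpow_le_rpow (mul_nonneg (by linarith) (hω.pos _ h0).le) h1 hr.le
        calc D * ω (m / M) ^ r = D / l ^ r * (l ^ r * ω (m / M) ^ r) := by
              have : l ^ r ≠ 0 := by linarith
              rw [← mul_assoc, div_mul_cancel₀ _ this]
          _ ≤ D / l ^ r * ω m ^ r := by gcongr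
    have hhigh : ∑ n ∈ Finset.Ico (m / M) m, ω (n + 1) ^ r / (n + 1 : ℕ) ≤ M * ω m ^ r := by
      have hmpos : (0 : ℝ) < m := by exact_mod_cast hm
      calc _ ≤ ∑ n ∈ Finset.Ico (m / M) m, ω m ^ r * (M / m) := by
            refine Finset.sum_le_sum fun n hn => ?_
            rw [Finset.mem_Ico] at hn
            rw [div_eq_mul_inv]
            have h1 : ω (n + 1) ≤ ω m := hω.mono _ _ (by lia) (by lia)
            have h2 : m < (n + 1) * M := by
              rw [← Nat.div_lt_iff_lt_mul (by lia)]
              lia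
            have h3 : ((n + 1 : ℕ) : ℝ)⁻¹ ≤ M / m := by
              rw [inv_le_iff_one_le_mul₀ (by positivity), div_mul_eq_mul_div,
                one_le_div hmpos]
              rw [mul_comm] at h2
              exact_mod_cast h2.le
            have h4 := hω.pos (n + 1) (by lia)
            gcongr
        _ = (m - m / M : ℕ) * (ω m ^ r * (M / m)) := by simp
        _ ≤ m * (ω m ^ r * (M / m)) := by
            gcongr
            exact Nat.sub_le _ _
        _ = M * ω m ^ r := by field_simp
    rw [Finset.range_eq_Ico, ← Finset.sum_Ico_consecutive _ (Nat.zero_le (m / M)) hkm.le,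
      ← Finset.range_eq_Ico]
    calc _ ≤ D / l ^ r * ω m ^ r + M * ω m ^ r := add_le_add hlow hhigh
      _ = D * ω m ^ r := by rw [← add_mul, hDeq]

/-- The upper half of the range suffices: doubling keeps the weight there at least `ω m / θ`. -/
theorem IsDoublingWeight.exists_le_sum (hω : IsDoublingWeight ω) {r : ℝ} (hr : 0 < r) :
    ∃ c : ℝ, 0 < c ∧ ∀ m, 1 ≤ m →
      c * ω m ^ r ≤ ∑ n ∈ Finset.range m, ω (n + 1) ^ r / (n + 1 : ℕ) := by
  obtain ⟨θ, hθ, hd⟩ := hω.doubling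
  have hθ0 : 0 < θ := by linarith
  refine ⟨(2 * θ ^ r)⁻¹, by positivity, fun m hm => ?_⟩
  have hmpos : (0 : ℝ) < m := by exact_mod_cast hm
  have hωm := hω.pos m hm
  calc (2 * θ ^ r)⁻¹ * ω m ^ r = (m / 2) * ((ω m / θ) ^ r * (m : ℝ)⁻¹) := by
        rw [Real.div_rpow hωm.le hθ0.le]
        field_simp
    _ ≤ (m - m / 2 : ℕ) * ((ω m / θ) ^ r * (m : ℝ)⁻¹) := by
        gcongr
        rw [div_le_iff₀ two_pos]
        exact_mod_cast (by lia : m ≤ (m - m / 2) * 2)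
    _ = ∑ n ∈ Finset.Ico (m / 2) m, (ω m / θ) ^ r * (m : ℝ)⁻¹ := by simp
    _ ≤ ∑ n ∈ Finset.Ico (m / 2) m, ω (n + 1) ^ r / (n + 1 : ℕ) := by
        refine Finset.sum_le_sum fun n hn => ?_
        rw [Finset.mem_Ico] at hn
        rw [div_eq_mul_inv (ω (n + 1) ^ r)]
        have h1 : ω m / θ ≤ ω (n + 1) := by
          rw [div_le_iff₀' hθ0]
          exact (hω.mono m (2 * (n + 1)) hm (by lia)).trans (hd _ (by lia))
        have h2 : ((n + 1 : ℕ) : ℝ) ≤ m := by exact_mod_cast hn.2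
        have h3 := hω.pos (n + 1) (by lia)
        gcongr
    _ ≤ _ := by
        refine Finset.sum_le_sum_of_subset_of_nonneg
          (fun n hn => Finset.mem_range.2 (Finset.mem_Ico.1 hn).2) fun n _ _ => ?_
        have h3 := hω.pos (n + 1) (by lia)
        positivity

/-- The sequence `ω(1), ..., ω(m), 0, 0, ...`. -/
noncomputable def truncation (ω : ℕ → ℝ) (m n : ℕ) : ℝ≥0∞ :=
  if n < m then ENNReal.ofReal (ω (n + 1)) else 0

theorem IsDoublingWeight.weightedNorm_truncation (hω : IsDoublingWeight ω) {q : ℝ≥0∞}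
    (hq : 0 < q) (hq' : q ≠ ∞) (m : ℕ) :
    weightedNorm q (truncation ω m) = ENNReal.ofReal
      (∑ n ∈ Finset.range m, ω (n + 1) ^ q.toReal / (n + 1 : ℕ)) ^ (1 / q.toReal) := by
  have hr : 0 < q.toReal := ENNReal.toReal_pos hq.ne' hq'
  rw [weightedNorm, if_neg hq', tsum_eq_sum (s := Finset.range m)]
  · rw [ENNReal.ofReal_sum_of_nonneg]
    · congr 1
      refine Finset.sum_congr rfl fun n hn => ?_
      rw [truncation, if_pos (Finset.mem_range.1 hn), ENNReal.ofReal_rpow_of_pos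
        (hω.pos _ (by lia)), ENNReal.ofReal_div_of_pos (by positivity), ENNReal.ofReal_natCast]
    · intro n _
      have := hω.pos (n + 1) (by lia)
      positivity
  · intro n hn
    rw [truncation, if_neg (by simpa using hn), ENNReal.zero_rpow_of_pos hr, ENNReal.zero_div]

theorem ofReal_mul_rpow_rpow_one_div {D t r : ℝ} (hD : 0 < D) (ht : 0 < t) (hr : 0 < r) :
    ENNReal.ofReal (D * t ^ r) ^ (1 / r) = ENNReal.ofReal (D ^ (1 / r) * t) := by
  rw [ENNReal.ofReal_rpow_of_pos (by positivity), Real.mul_rpow hD.le (by positivity),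
    ← Real.rpow_mul ht.le, mul_one_div_cancel hr.ne', Real.rpow_one]

theorem IsDoublingWeight.exists_weightedNorm_truncation_le (hω : IsDoublingWeight ω)
    (hi : 0 < lowerDilationIndex ω) {q : ℝ≥0∞} (hq : 0 < q) :
    ∃ D : ℝ, 0 < D ∧ ∀ m, 1 ≤ m →
      weightedNorm q (truncation ω m) ≤ ENNReal.ofReal (D * ω m) := by
  by_cases hq' : q = ∞
  · refine ⟨1, one_pos, fun m hm => ?_⟩
    rw [weightedNorm, if_pos hq', one_mul]
    refine iSup_le fun n => ?_
    unfold truncation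
    split_ifs with h
    · exact ENNReal.ofReal_le_ofReal (hω.mono _ _ (by lia) h)
    · exact zero_le
  · have hr : 0 < q.toReal := ENNReal.toReal_pos hq.ne' hq'
    obtain ⟨D, hD, h⟩ := hω.exists_sum_le hi hr
    refine ⟨D ^ (1 / q.toReal), by positivity, fun m hm => ?_⟩
    rw [hω.weightedNorm_truncation hq hq', ← ofReal_mul_rpow_rpow_one_div hD (hω.pos m hm) hr]
    gcongr
    exact h m hm

theorem IsDoublingWeight.exists_le_weightedNorm_truncation (hω : IsDoublingWeight ω)
    {q : ℝ≥0∞} (hq : 0 < q) :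
    ∃ c : ℝ, 0 < c ∧ ∀ m, 1 ≤ m →
      ENNReal.ofReal (c * ω m) ≤ weightedNorm q (truncation ω m) := by
  by_cases hq' : q = ∞
  · refine ⟨1, one_pos, fun m hm => ?_⟩
    rw [weightedNorm, if_pos hq', one_mul]
    refine le_iSup_of_le (m - 1) ?_
    rw [truncation, if_pos (by lia), Nat.sub_add_cancel hm]
  · have hr : 0 < q.toReal := ENNReal.toReal_pos hq.ne' hq'
    obtain ⟨c, hc, h⟩ := hω.exists_le_sum hr
    refine ⟨c ^ (1 / q.toReal), by positivity, fun m hm => ?_⟩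
    rw [hω.weightedNorm_truncation hq hq', ← ofReal_mul_rpow_rpow_one_div hc (hω.pos m hm) hr]
    gcongr
    exact h m hm

end Weights

/-! ### Test vectors and democracy. -/

section Democracy

variable {𝕜 X : Type*} [RCLike 𝕜] [AddCommGroup X] [Module 𝕜 X] [Norm X]

namespace MBasis

variable (B : MBasis 𝕜 X)

/-- The sum of `e n` over `A` plus twice its sum over `D`: every greedy ordering lists `D`
before `A`. -/
noncomputable def testVector (A D : Finset ℕ) : X :=
  ∑ n ∈ A, B.e n + (2 : 𝕜) • ∑ n ∈ D, B.e n

variable {B}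

theorem coord_testVector (A D : Finset ℕ) (n : ℕ) :
    B.coord n (B.testVector A D) = (if n ∈ A then 1 else 0) + 2 * if n ∈ D then 1 else 0 := by
  rw [testVector, map_add, map_smul, coord_sum, coord_sum, smul_eq_mul]

theorem sigma_testVector_le_norm (A D : Finset ℕ) (m : ℕ) :
    B.sigma m (B.testVector A D) ≤ ENNReal.ofReal ‖B.testVector A D‖ := by
  simpa using B.sigma_le (A := ∅) (m := m) (by simp) 0 (B.testVector A D)

variable [IsQuasiBanach 𝕜 X]

theorem sigma_testVector_le (A D : Finset ℕ) {m : ℕ} (hm : A.card ≤ m) :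
    B.sigma m (B.testVector A D) ≤ ENNReal.ofReal (2 * ‖∑ n ∈ D, B.e n‖) := by
  refine (B.sigma_le hm 1 _).trans (le_of_eq ?_)
  have : B.testVector A D - ∑ n ∈ A, (1 : ℕ → 𝕜) n • B.e n = (2 : 𝕜) • ∑ n ∈ D, B.e n := by
    simp [testVector]
  rw [this, IsQuasiBanach.norm_smul, RCLike.norm_ofNat]

theorem sigma_testVector_eq_zero {A D : Finset ℕ} (hAD : Disjoint A D) {m : ℕ}
    (hm : A.card + D.card ≤ m) : B.sigma m (B.testVector A D) = 0 := by
  classical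
  have h1 := B.sigma_le (A := A ∪ D) (m := m) (by rwa [Finset.card_union_of_disjoint hAD])
    (fun n => if n ∈ D then 2 else 1) (B.testVector A D)
  have h2 : B.testVector A D - ∑ n ∈ A ∪ D, (if n ∈ D then 2 else 1 : 𝕜) • B.e n = 0 := by
    rw [Finset.sum_union hAD, sub_eq_zero, testVector, Finset.smul_sum]
    congr 1
    · exact Finset.sum_congr rfl fun n hn => by
        rw [if_neg (Finset.disjoint_left.1 hAD hn), one_smul]
    · exact Finset.sum_congr rfl fun n hn => by rw [if_pos hn]
  rw [h2, (IsQuasiBanach.norm_eq_zero 𝕜 0).2 rfl, ENNReal.ofReal_zero] at h1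
  exact le_antisymm h1 zero_le

theorem le_gamma_testVector {K : ℝ} (hK0 : 0 < K)
    (hK : ∀ (A : Finset ℕ) (x : X), ‖B.proj A x‖ ≤ K * ‖x‖) {A D : Finset ℕ}
    (hAD : Disjoint A D) {m : ℕ} (hm : m ≤ D.card) :
    ENNReal.ofReal (‖∑ n ∈ A, B.e n‖ / K) ≤ B.gamma m (B.testVector A D) := by
  classical
  obtain ⟨π, hπ⟩ := B.exists_isGreedyOrdering (B.testVector A D)
  have hcD : ∀ n ∈ D, B.coord n (B.testVector A D) = 2 := fun n hn => by
    rw [coord_testVector, if_neg (Finset.disjoint_right.1 hAD hn), if_pos hn]; simp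
  have hcD' : ∀ n ∉ D, ‖B.coord n (B.testVector A D)‖ ≤ 1 := fun n hn => by
    rw [coord_testVector, if_neg hn]
    split_ifs <;> simp
  -- If `π i` were outside `D`, all of `D` would be listed before position `i`, forcing `|D| ≤ i <
  -- m`.
  have hπD : ∀ i < m, π i ∈ D := by
    intro i hi
    by_contra h
    have hsub : D ⊆ (Finset.range i).image π := by
      intro n hn
      obtain ⟨j, rfl⟩ := hπ.support_subset n (by rw [hcD n hn]; exact two_ne_zero)
      refine Finset.mem_image_of_mem π (Finset.mem_range.2 ?_)
      by_contra hj
      have h1 := (hπ.antitone i j (not_lt.1 hj)).trans (hcD' _ h)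
      rw [hcD _ hn, RCLike.norm_ofNat] at h1
      norm_num at h1
    have h1 := (Finset.card_le_card hsub).trans Finset.card_image_le
    rw [Finset.card_range] at h1
    lia
  refine le_iSup₂_of_le π hπ (ENNReal.ofReal_le_ofReal ?_)
  rw [B.greedySum_eq_proj hπ.injective, div_le_iff₀' hK0]
  refine le_trans (le_of_eq ?_) (hK A _)
  rw [B.proj_eq_sum]
  intro n hn
  have hnD := Finset.disjoint_left.1 hAD hn
  have hnG : n ∉ (Finset.range m).image π := fun h => by
    obtain ⟨i, hi, rfl⟩ := Finset.mem_image.1 h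
    exact hnD (hπD i (Finset.mem_range.1 hi))
  rw [map_sub, coord_proj, if_neg hnG, coord_testVector, if_pos hn, if_neg hnD]
  simp

theorem exists_approxNorm_testVector_le (B : MBasis 𝕜 X) {ω : ℕ → ℝ} (hω : IsDoublingWeight ω)
    (hi : 0 < lowerDilationIndex ω) {q : ℝ≥0∞} (hq : 0 < q) :
    ∃ E : ℝ, 0 < E ∧ ∀ A D : Finset ℕ, Disjoint A D → 1 ≤ A.card → A.card ≤ D.card →
      B.approxNorm ω q (B.testVector A D) ≤ ENNReal.ofReal (E *
        (ω A.card * (‖∑ n ∈ A, B.e n‖ + ‖∑ n ∈ D, B.e n‖) +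
          ω D.card * ‖∑ n ∈ D, B.e n‖)) := by
  obtain ⟨κ, hκ, hadd⟩ := IsQuasiBanach.norm_add_le 𝕜 (X := X)
  obtain ⟨θ, hθ, hd⟩ := hω.doubling
  obtain ⟨C, hC, htri⟩ := exists_weightedNorm_le_add hq
  obtain ⟨S, hS, htrunc⟩ := hω.exists_weightedNorm_truncation_le hi hq
  have hω1 := hω.pos 1 le_rfl
  have hnn : ∀ x : X, 0 ≤ ‖x‖ := IsQuasiBanach.norm_nonneg 𝕜
  refine ⟨(1 / ω 1 + C * S) * (2 * κ) + C * S * θ * 2, by positivity, fun A D hAD hA hcard => ?_⟩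
  set x := B.testVector A D with hx
  set α := ‖∑ n ∈ A, B.e n‖
  set β := ‖∑ n ∈ D, B.e n‖
  have hα0 : 0 ≤ α := hnn _
  have hβ0 : 0 ≤ β := hnn _
  have hD : 1 ≤ D.card := hA.trans hcard
  have hωA := hω.pos _ hA
  have hωD := hω.pos _ hD
  have hxn : ‖x‖ ≤ 2 * κ * (α + β) := by
    have h1 := hadd (∑ n ∈ A, B.e n) ((2 : 𝕜) • ∑ n ∈ D, B.e n)
    rw [IsQuasiBanach.norm_smul, RCLike.norm_ofNat] at h1
    refine h1.trans ?_
    nlinarith [mul_nonneg (by linarith : 0 ≤ κ) hα0]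
  have hx1 : ‖x‖ ≤ 1 / ω 1 * (ω A.card * ‖x‖) := by
    rw [one_div, le_inv_mul_iff₀ hω1]
    exact mul_le_mul_of_nonneg_right (hω.mono _ _ le_rfl hA) (hnn x)
  -- The second truncation stops at `2 * D.card`, which is at least `|A| + |D|`; beyond it the error
  -- vanishes.
  have hpt : ∀ n, ENNReal.ofReal (ω (n + 1)) * B.sigma (n + 1) x ≤
        ENNReal.ofReal ‖x‖ * truncation ω A.card n ∨
      ENNReal.ofReal (ω (n + 1)) * B.sigma (n + 1) x ≤
        ENNReal.ofReal (2 * β) * truncation ω (2 * D.card) n := by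
    intro n
    unfold truncation
    by_cases h1 : n < A.card
    · left
      rw [if_pos h1, mul_comm]
      gcongr
      exact sigma_testVector_le_norm A D _
    · right
      by_cases h2 : n < 2 * D.card
      · rw [if_pos h2, mul_comm]
        gcongr
        exact sigma_testVector_le A D (by lia)
      · rw [hx, sigma_testVector_eq_zero hAD (by lia), mul_zero]
        exact zero_le
  have h2 := htri _ _ _ hpt
  rw [weightedNorm_const_mul hq, weightedNorm_const_mul hq] at h2
  have h3 : weightedNorm q (fun n => ENNReal.ofReal (ω (n + 1)) * B.sigma (n + 1) x) ≤
      ENNReal.ofReal (C * (‖x‖ * (S * ω A.card) + 2 * β * (S * ω (2 * D.card)))) := by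
    have hω2 := hω.pos (2 * D.card) (by lia)
    refine h2.trans ?_
    rw [ENNReal.ofReal_mul hC.le, ENNReal.ofReal_add (mul_nonneg (hnn x) (by positivity))
      (by positivity), ENNReal.ofReal_mul (hnn x), ENNReal.ofReal_mul (by positivity : 0 ≤ 2 * β)]
    gcongr
    · exact htrunc _ hA
    · exact htrunc _ (by lia)
  rw [approxNorm, classNorm_eq]
  refine (add_le_add_right h3 _).trans ?_
  rw [← ENNReal.ofReal_add (hnn x)
    (mul_nonneg hC.le (add_nonneg (mul_nonneg (hnn x) (by positivity))
      (mul_nonneg (by positivity) (mul_nonneg hS.le (hω.pos _ (by lia)).le))))]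
  refine ENNReal.ofReal_le_ofReal ?_
  calc ‖x‖ + C * (‖x‖ * (S * ω A.card) + 2 * β * (S * ω (2 * D.card)))
      ≤ 1 / ω 1 * (ω A.card * ‖x‖) +
          C * (‖x‖ * (S * ω A.card) + 2 * β * (S * (θ * ω D.card))) := by
        gcongr
        exact hd _ hD
    _ = (1 / ω 1 + C * S) * (ω A.card * ‖x‖) + C * S * θ * 2 * (ω D.card * β) := by ring
    _ ≤ (1 / ω 1 + C * S) * (ω A.card * (2 * κ * (α + β))) +
          C * S * θ * 2 * (ω D.card * β) := by gcongr
    -- The nonnegative cross terms complete the expression to a product with a single constant.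
    _ ≤ (1 / ω 1 + C * S) * (ω A.card * (2 * κ * (α + β))) +
          C * S * θ * 2 * (ω D.card * β) + ((1 / ω 1 + C * S) * (2 * κ) * (ω D.card * β) +
          C * S * θ * 2 * (ω A.card * (α + β))) := le_add_of_nonneg_right (by positivity)
    _ = _ := by ring

theorem exists_le_greedyNorm_testVector (hB : B.IsUnconditional) {ω : ℕ → ℝ}
    (hω : IsDoublingWeight ω) {q : ℝ≥0∞} (hq : 0 < q) :
    ∃ c : ℝ, 0 < c ∧ ∀ A D : Finset ℕ, Disjoint A D → 1 ≤ D.card →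
      ENNReal.ofReal (c * (ω D.card * ‖∑ n ∈ A, B.e n‖)) ≤
        B.greedyNorm ω q (B.testVector A D) := by
  obtain ⟨K, hK0, hK⟩ := hB.exists_pos
  obtain ⟨c, hc, htrunc⟩ := hω.exists_le_weightedNorm_truncation hq
  refine ⟨c / K, by positivity, fun A D hAD hD => ?_⟩
  have hα0 : 0 ≤ ‖∑ n ∈ A, B.e n‖ / K :=
    div_nonneg (IsQuasiBanach.norm_nonneg 𝕜 _) hK0.le
  calc _ = ENNReal.ofReal (‖∑ n ∈ A, B.e n‖ / K) * ENNReal.ofReal (c * ω D.card) := by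
        rw [← ENNReal.ofReal_mul hα0]
        congr 1
        ring
    _ ≤ ENNReal.ofReal (‖∑ n ∈ A, B.e n‖ / K) * weightedNorm q (truncation ω D.card) := by
        gcongr
        exact htrunc _ hD
    _ = weightedNorm q fun n =>
          ENNReal.ofReal (‖∑ n ∈ A, B.e n‖ / K) * truncation ω D.card n :=
        (weightedNorm_const_mul hq _ _).symm
    _ ≤ weightedNorm q fun n =>
          ENNReal.ofReal (ω (n + 1)) * B.gamma (n + 1) (B.testVector A D) := by
        refine weightedNorm_mono q fun n => ?_
        unfold truncation
        split_ifs with h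
        · rw [mul_comm]
          gcongr
          exact le_gamma_testVector hK0 hK hAD h
        · rw [mul_zero]; exact zero_le
    _ ≤ _ := le_add_self

/-- The embedding of `𝒜_q^ω` into `𝒢_q^ω` compares the sum over `A` with the sum over `D` if `D` is
sufficiently larger than `A`. -/
theorem exists_norm_sum_le_of_embeds (hB : B.IsUnconditional) {ω : ℕ → ℝ}
    (hω : IsDoublingWeight ω) (hi : 0 < lowerDilationIndex ω) {q : ℝ≥0∞} (hq : 0 < q)
    (h : Embeds (B.approxNorm ω q) (B.greedyNorm ω q)) :
    ∃ (L : ℕ) (C : ℝ), 1 ≤ L ∧ 0 < C ∧ ∀ A D : Finset ℕ, Disjoint A D →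
      L * A.card ≤ D.card → ‖∑ n ∈ A, B.e n‖ ≤ C * ‖∑ n ∈ D, B.e n‖ := by
  obtain ⟨E, hE, happ⟩ := B.exists_approxNorm_testVector_le hω hi hq
  obtain ⟨c, hc, hgr⟩ := exists_le_greedyNorm_testVector hB hω hq
  obtain ⟨-, C, hC, hemb⟩ := h
  -- With this factor the term `C * E * ω A.card * α` is at most half of `c * ω D.card * α`, so it
  -- can be absorbed.
  obtain ⟨L, hL, hωL⟩ := hω.exists_mul_le hi (2 * (C * E) / c)
  refine ⟨L, 1 + 2 * (C * E) / c, hL, by positivity, fun A D hAD hcard => ?_⟩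
  have hβ0 : 0 ≤ ‖∑ n ∈ D, B.e n‖ := IsQuasiBanach.norm_nonneg 𝕜 _
  rcases Nat.eq_zero_or_pos A.card with h0 | hA
  · rw [Finset.card_eq_zero.1 h0, Finset.sum_empty, (IsQuasiBanach.norm_eq_zero 𝕜 0).2 rfl]
    positivity
  have hAD' : A.card ≤ D.card := (Nat.le_mul_of_pos_left _ hL).trans hcard
  have h1 := happ A D hAD hA hAD'
  have h2 := (hgr A D hAD (hA.trans_le hAD')).trans
    ((hemb _ (h1.trans_lt ENNReal.ofReal_lt_top)).trans (mul_le_mul_right h1 _))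
  have h3 := hωL A.card D.card hA hcard
  have hωA := hω.pos _ hA
  have hωD := hω.pos _ (hA.trans_le hAD')
  have hα0 : 0 ≤ ‖∑ n ∈ A, B.e n‖ := IsQuasiBanach.norm_nonneg 𝕜 _
  set α := ‖∑ n ∈ A, B.e n‖
  set β := ‖∑ n ∈ D, B.e n‖
  rw [← ENNReal.ofReal_mul hC.le, ENNReal.ofReal_le_ofReal_iff (by positivity)] at h2
  rw [div_mul_eq_mul_div, div_le_iff₀ hc] at h3
  have h4 : 2 * (C * E) * ω A.card * (α + β) ≤ ω D.card * c * (α + β) := by gcongr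
  have h5 : ω D.card * (c * α) ≤ ω D.card * ((c + 2 * (C * E)) * β) := by linarith
  have h6 := le_of_mul_le_mul_left h5 hωD
  rw [← mul_le_mul_iff_of_pos_left hc]
  calc c * α ≤ (c + 2 * (C * E)) * β := h6
    _ = c * ((1 + 2 * (C * E) / c) * β) := by field_simp

theorem IsUnconditional.isDemocratic_of_embeds (hB : B.IsUnconditional) {ω : ℕ → ℝ}
    (hω : IsDoublingWeight ω) (hi : 0 < lowerDilationIndex ω) {q : ℝ≥0∞} (hq : 0 < q)
    (h : Embeds (B.approxNorm ω q) (B.greedyNorm ω q)) : B.IsDemocratic := by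
  obtain ⟨L, C, hL, hC, hlarge⟩ := exists_norm_sum_le_of_embeds hB hω hi hq h
  obtain ⟨κ, hκ, hadd⟩ := IsQuasiBanach.norm_add_le 𝕜 (X := X)
  obtain ⟨K, hK0, hK⟩ := hB.exists_pos
  obtain ⟨c₁, c₂, hc₁, hc⟩ := B.semi_normalized
  have hc₂ : 0 < c₂ := hc₁.trans_le ((hc 0).1.1.trans (hc 0).1.2)
  have h0 : ‖(0 : X)‖ = 0 := (IsQuasiBanach.norm_eq_zero 𝕜 0).2 rfl
  refine ⟨(2 * κ) ^ (2 * L) * (C + c₂ * (K / c₁)), fun A D hAD hcard => ?_⟩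
  have hβ0 : 0 ≤ ‖∑ n ∈ D, B.e n‖ := IsQuasiBanach.norm_nonneg 𝕜 _
  rcases D.eq_empty_or_nonempty with rfl | ⟨d, hd⟩
  · rw [Finset.card_empty, Nat.le_zero, Finset.card_eq_zero] at hcard
    simp [hcard, h0]
  have hβ : c₁ ≤ K * ‖∑ n ∈ D, B.e n‖ := by
    have h1 := hK {d} (∑ n ∈ D, B.e n)
    rw [B.proj_eq_sum fun n hn => by
      rw [coord_sum, if_pos (by rwa [Finset.mem_singleton.1 hn])], Finset.sum_singleton] at h1
    exact (hc d).1.1.trans h1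
  rw [mul_assoc]
  -- A piece with at most `D.card / L` elements is compared with `D` by `hlarge`. When that quotient
  -- is at most `1`, pieces have at most one element and semi-normalization suffices.
  refine norm_sum_le_of_card_le_mul hκ hadd (by positivity) B.e (max 1 (D.card / L)) (2 * L) A
    (hcard.trans ?_) fun t ht htcard => ?_
  · have h1 := Nat.lt_mul_div_succ D.card hL
    calc D.card ≤ L * (D.card / L + 1) := h1.le
      _ ≤ L * (max 1 (D.card / L) + max 1 (D.card / L)) := by
        gcongr
        · exact le_max_right _ _
        · exact le_max_left _ _
      _ = _ := by ring
  · rw [add_mul]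
    rcases le_total (D.card / L) 1 with h1 | h1
    · rw [max_eq_left h1] at htcard
      refine le_trans ?_ (le_add_of_nonneg_left (by positivity))
      have h2 : ‖∑ n ∈ t, B.e n‖ ≤ c₂ := by
        rcases Finset.card_le_one_iff_subset_singleton.1 htcard with ⟨i, hi⟩
        rcases Finset.subset_singleton_iff.1 hi with rfl | rfl
        · simpa [h0] using hc₂.le
        · simpa using (hc i).1.2
      refine h2.trans ?_
      rw [mul_assoc]
      refine le_mul_of_one_le_right hc₂.le ?_
      rw [div_mul_eq_mul_div, one_le_div hc₁]
      exact hβ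
    · rw [max_eq_right h1] at htcard
      refine (hlarge t D (Finset.disjoint_of_subset_left ht hAD) ?_).trans
        (le_add_of_nonneg_right (by positivity))
      exact (Nat.mul_le_mul_left L htcard).trans (Nat.mul_div_le _ _)

end MBasis

end Democracy

theorem embeds_of_le {X : Type*} {Φ Ψ : X → ℝ≥0∞} {C : ℝ} (hC : 0 < C)
    (h : ∀ x, Ψ x ≤ ENNReal.ofReal C * Φ x) : Embeds Φ Ψ :=
  ⟨fun x hx => (h x).trans_lt (ENNReal.mul_lt_top ENNReal.ofReal_lt_top hx),
    C, hC, fun x _ => h x⟩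

end GreedyApprox

theorem theorem1p4 {𝕜 X : Type*} [RCLike 𝕜] [AddCommGroup X] [Module 𝕜 X] [Norm X]
    [GreedyApprox.IsQuasiBanach 𝕜 X]
    (ω : ℕ → ℝ) (hω : GreedyApprox.IsDoublingWeight ω)
    (hi : 0 < GreedyApprox.lowerDilationIndex ω)
    (B : GreedyApprox.MBasis 𝕜 X) (hB : B.IsUnconditional) :
    (B.IsGreedy → ∀ q : ℝ≥0∞, 0 < q →
      GreedyApprox.EquivalentSpaces (B.approxNorm ω q) (B.greedyNorm ω q)) ∧
    ((∃ q : ℝ≥0∞, 0 < q ∧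
      GreedyApprox.EquivalentSpaces (B.approxNorm ω q) (B.greedyNorm ω q)) → B.IsGreedy) := by
  refine ⟨?_, ?_⟩
  · rintro ⟨C, -, h⟩ q hq
    -- The constant must be at least `1` to cover the summand `‖x‖` as well.
    have hC : ENNReal.ofReal C ≤ ENNReal.ofReal (max C 1) :=
      ENNReal.ofReal_le_ofReal (le_max_left _ _)
    exact ⟨GreedyApprox.embeds_of_le (C := max C 1) (by positivity) fun x =>
        GreedyApprox.classNorm_le_of_le hq (le_max_right _ _) x fun m hm =>
          (h x m hm).1.trans (mul_le_mul_left hC _),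
      GreedyApprox.embeds_of_le (C := max C 1) (by positivity) fun x =>
        GreedyApprox.classNorm_le_of_le hq (le_max_right _ _) x fun m hm =>
          (h x m hm).2.trans (mul_le_mul_left hC _)⟩
  · rintro ⟨q, hq, h⟩
    exact (hB.isDemocratic_of_embeds hω hi hq h.1).isGreedy hB
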